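/- **Permutation relation for Yangian invariants with a box.** Let $\sigma$ be a decorated permutation of $n$ legs ($i\le\sigma(i)\le i+n$, a permutation modulo $n$) of helicity degree $k=\#\{i:\sigma(i)>n\}$, such that the legs $n-1$, $n$ are not fixed modulo $n$, the four legs $n-1,\ n,\ \sigma(n-1),\ \sigma(n)$ are distinct modulo $n$, and $$\sigma(n-1)<\sigma(n),\qquad \sigma^{-1}(n-1)<\sigma^{-1}(n).$$ *On-shell diagrams with a box.* Such a diagram for $\sigma$ consists of a four-point box on legs $p<q<n-1<n$, a dressed identity ($\bar\sigma(i)=i$ or $i+n$; $U$ denotes the set of legs with $\bar\sigma(i)=i+n$) on the other legs, and BCFW bridges $(a_I,b_I)$ between legs $a_I<b_I\le n-2$ separated only by fixed legs. Adding a bridge exchanges the images of $a_I<b_I$ (so that afterwards $\sigma(a_I)<\sigma(b_I)$) and keeps the order of $\sigma^{-1}(n-1),\sigma^{-1}(n)$; it multiplies the Grassmannian matrix on the right by $\mathcal B(a_I,b_I;\alpha_I)=1+\alpha_I E_{a_Ib_I}$. Starting from $\bar\sigma$ (where $p\mapsto n-1$, $q\mapsto n$, $n-1\mapsto p+n$,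 $n\mapsto q+n$) one arrives at $\sigma$. *Kinematics.* Let $p_i=\lambda_i\tilde\lambda_i$, $s_{ij}=(p_i+p_j)^2=\det(p_i+p_j)=\langle ij\rangle[ij]$ and $\sum_ip_i=0$. Removing the bridges successively, the outermost first, shifts $\lambda_{b}\to\lambda_{b}-\alpha\lambda_{a}$, $\tilde\lambda_{a}\to\tilde\lambda_{a}+\alpha\tilde\lambda_{b}$ and $\tilde\eta_a\to\tilde\eta_a+\alpha\tilde\eta_b$. Hats denote the data after all shifts; the hatted legs $q$ and $p$ are the internal lines of the box, also denoted $\widehat{n-2}$ and $\hat 1$. The delta functions $\delta(C\cdot\tilde\lambda)\,\delta(\lambda\cdot C^\perp)$ with $C=C_0\mathcal B\cdots\mathcal B$ amount to $\delta(\sum_i\lambda_i\tilde\lambda_i)$ together with $2n-8$ equations: $\hat{\tilde\lambda}_i=0$ for $i\in U$ and $\hat\lambda_i=0$ for the other legs outside the box. The Yangian invariant $Y_\sigma^{(k)}$, with $\delta(\sum_i\lambda_i\tilde\lambda_i)$ stripped off, is $$Y^{(k)}_\sigma=\sum_{\alpha}\frac{\delta^{k\times4}(C\cdot\tilde\eta)}{\prod_I\alpha_I\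 J(\alpha)\ \langle\hat p\,\hat q\rangle\langle\hat q\ n{-}1\rangle\langle n{-}1\ n\rangle\langle n\ \hat p\rangle},$$ the sum running over the solutions with all $\alpha_I\ne0$ of these equations, whose Jacobian with respect to $\alpha$ is $J$. *Claim.* An on-shell diagram with a box at the legs $n-1$, $n$ exists for $\sigma$. For every such diagram, $C$ has $k$ rows. Moreover, suppose that the diagram is of tree level: it has $2n-8$ bridges and the delta functions have exactly one solution $\alpha$ at the given momenta. Suppose also that $s_{\widehat{n-2},n-1}\neq0$ and $s_{\widehat{n-2},n}\ne0$ there. Then $$Y_\sigma^{(k)}(1,\dots,n-2,n,n-1)=\frac{s_{\widehat{n-2},n-1}}{s_{\widehat{n-2},n}}\;Y_\sigma^{(k)}(1,\dots,n-2,n-1,n),$$ where $$p_{\hat1}+p_{\widehat{n-2}}+p_{n-1}+p_n=0,\qquad \frac{s_{\widehat{n-2},n-1}}{s_{\widehat{n-2},n}}=-\frac{\langle\widehat{n-2}\ n{-}1\rangle\langle\hat1\ n\rangle}{\langle\widehat{n-2}\ n\rangle\langle\hat1\ n{-}1\rangle}.$$ The hatted spinors are obtained recursively by the BCFW shifts.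 If, on removing the $I$-th bridge $(a,b)$, the remaining diagram consists of two parts joined by a single internal line, with external legs $L\ni a$ and $L^c\ni b$ (that is, the columns in $L$ and in $L^c$ of the remaining Grassmannian matrix have ranks adding up to $k+1$), then $\alpha_I$ satisfies the on-shell condition $$\Big(\sum_{i\in L}p_i+\alpha_I\,\lambda_a\tilde\lambda_b\Big)^2=0,$$ in which the spinors are those obtained after removing the preceding bridges. -/

import Mathlib

/-! Conventions.  There are `n = m + 2` external legs, labelled `0, …, m + 1` by `Fin (m + 2)`:
label `i` is the leg usually called `i + 1`.  The two legs to be exchanged are the last two. -/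

namespace OnShell

open Matrix

/-! ### Decorated permutations and their decomposition into a box and bridges -/

/-- A decorated permutation of `n` legs: `i ≤ σ i ≤ i + n`, and `σ` is a permutation modulo `n`.
A leg fixed modulo `n` carries the decoration `σ i = i` or `σ i = i + n`. -/
structure DecoratedPerm (n : ℕ) where
  toFun : Fin n → ℕ
  le_apply : ∀ i : Fin n, (i : ℕ) ≤ toFun i
  apply_le : ∀ i : Fin n, toFun i ≤ (i : ℕ) + n
  inj : Function.Injective fun i => toFun i % n

/-- `σ i` modulo `n`. -/
def DecoratedPerm.image {n : ℕ} (σ : DecoratedPerm n) (i : Fin n) : Fin n :=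
  ⟨σ.toFun i % n, Nat.mod_lt _ i.pos⟩

/-- The number `k` of a decorated permutation (the cell lies in `G(k, n)`). -/
def DecoratedPerm.k {n : ℕ} (σ : DecoratedPerm n) : ℕ :=
  (Finset.univ.filter fun i => n ≤ σ.toFun i).card

/-- The last leg but one, "leg `n - 1`". -/
def legA (m : ℕ) : Fin (m + 2) := ⟨m, by omega⟩

/-- The last leg, "leg `n`". -/
def legB (m : ℕ) : Fin (m + 2) := Fin.last (m + 1)

/-- `σ⁻¹(n - 1) < σ⁻¹(n)`. -/
def DecoratedPerm.PreimagesOrdered {m : ℕ} (σ : DecoratedPerm (m + 2)) : Prop :=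
  ∀ x y, σ.image x = legA m → σ.image y = legB m → x < y

/-- The box condition at the legs `n - 1` and `n`: neither leg is fixed, the four legs
`n - 1`, `n`, `σ (n - 1)`, `σ n` (modulo `n`) are different, and
`σ (n - 1) < σ n`, `σ⁻¹ (n - 1) < σ⁻¹ n`.
(That `σ n` is not `n - 1` modulo `n` follows from `σ⁻¹ (n - 1) < σ⁻¹ n`.) -/
structure DecoratedPerm.BoxCondition {m : ℕ} (σ : DecoratedPerm (m + 2)) : Prop where
  not_fixed_A : σ.image (legA m) ≠ legA m
  not_fixed_B : σ.image (legB m) ≠ legB m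
  image_A_ne : σ.image (legA m) ≠ legB m
  image_lt : σ.toFun (legA m) < σ.toFun (legB m)
  preimage_lt : σ.PreimagesOrdered

/-- `σ = (a b) ∘ σ'`: removing from `σ` a BCFW bridge between the legs `a < b`, both different
from `n - 1` and `n`, separated by fixed legs only, with `σ a < σ b`, in such a way that the order
of the preimages of `n - 1` and `n` is kept. -/
structure BridgeStep {m : ℕ} (σ : DecoratedPerm (m + 2)) (a b : Fin (m + 2))
    (σ' : DecoratedPerm (m + 2)) : Prop where
  lt : a < b
  lt_legA : b < legA m
  apply_lt : σ.toFun a < σ.toFun b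
  separated : ∀ c, a < c → c < b → σ.image c = c
  swap_eq : ∀ i, σ'.toFun i = σ.toFun (Equiv.swap a b i)
  ordered : σ'.PreimagesOrdered

/-- An on-shell diagram with a box attached directly to the legs `n - 1` and `n`: a four-point
box whose external legs are `p < q < n - 1 < n`; the other legs carry a "dressed identity"
(`unit` is the set of those among them with decoration `i + n`); and a list of BCFW bridges
`(a, b)` between legs, the outermost bridge first. -/
structure BoxDiagram (m : ℕ) where
  p : Fin (m + 2)
  q : Fin (m + 2)
  p_lt_q : p < q
  q_lt : q < legA m
  unit : Finset (Fin (m + 2))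
  unit_spec : ∀ i ∈ unit, i ≠ p ∧ i ≠ q ∧ i ≠ legA m ∧ i ≠ legB m
  bridges : List (Fin (m + 2) × Fin (m + 2))

variable {m : ℕ}

/-- The decorated permutation of the box of `D` (together with the dressed identity):
`p ↦ n - 1`, `q ↦ n`, `n - 1 ↦ p + n`, `n ↦ q + n`. -/
structure BoxDiagram.IsSeed (D : BoxDiagram m) (σ : DecoratedPerm (m + 2)) : Prop where
  apply_p : σ.toFun D.p = (legA m : ℕ)
  apply_q : σ.toFun D.q = (legB m : ℕ)
  apply_A : σ.toFun (legA m) = (D.p : ℕ) + (m + 2)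
  apply_B : σ.toFun (legB m) = (D.q : ℕ) + (m + 2)
  apply_unit : ∀ i ∈ D.unit, σ.toFun i = (i : ℕ) + (m + 2)
  apply_zero : ∀ i, i ∉ D.unit → i ≠ D.p → i ≠ D.q → i ≠ legA m → i ≠ legB m →
    σ.toFun i = (i : ℕ)

/-- `σ` is obtained by putting the bridges of the list on the box of `D`. -/
inductive BoxDiagram.IsBridgeChain (D : BoxDiagram m) :
    DecoratedPerm (m + 2) → List (Fin (m + 2) × Fin (m + 2)) → Prop
  | seed (σ : DecoratedPerm (m + 2)) : D.IsSeed σ → D.IsBridgeChain σ []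
  | bridge (σ σ' : DecoratedPerm (m + 2)) (a b : Fin (m + 2))
      (l : List (Fin (m + 2) × Fin (m + 2))) :
      BridgeStep σ a b σ' → D.IsBridgeChain σ' l → D.IsBridgeChain σ ((a, b) :: l)

/-- `D` is an on-shell diagram for `σ`. -/
def BoxDiagram.Represents (D : BoxDiagram m) (σ : DecoratedPerm (m + 2)) : Prop :=
  D.IsBridgeChain σ D.bridges

/-! ### Kinematics -/

/-- The odd vector space spanned by the Grassmann variables `η̃ᵢᴬ`. -/
abbrev OddSpace (n : ℕ) : Type := Fin n × Fin 4 → ℂ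

/-- External data: spinors `λᵢ`, `λ̃ᵢ` and odd variables `η̃ᵢᴬ` (for instance the generators
`Pi.single (i, A) 1`). -/
structure Kin (n : ℕ) where
  lam : Fin n → Fin 2 → ℂ
  lamt : Fin n → Fin 2 → ℂ
  eta : Fin n → Fin 4 → OddSpace n

namespace Kin

variable {n : ℕ}

/-- `⟨i j⟩`. -/
def angle (K : Kin n) (i j : Fin n) : ℂ := K.lam i 0 * K.lam j 1 - K.lam i 1 * K.lam j 0

/-- The momentum `pᵢ = λᵢ λ̃ᵢ`. -/
def mom (K : Kin n) (i : Fin n) : Matrix (Fin 2) (Fin 2) ℂ := vecMulVec (K.lam i) (K.lamt i)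

/-- `s_{ij} = (pᵢ + pⱼ)²`, the square of a momentum being its determinant. -/
def s (K : Kin n) (i j : Fin n) : ℂ := (K.mom i + K.mom j).det

/-- `∑ pᵢ = 0`. -/
def MomentumConserving (K : Kin n) : Prop := ∑ i, K.mom i = 0

/-- The external data with the legs relabelled by `π`. -/
def relabel (K : Kin n) (π : Equiv.Perm (Fin n)) : Kin n where
  lam i := K.lam (π i)
  lamt i := K.lamt (π i)
  eta i := K.eta (π i)

/-- The BCFW shift of the legs `a`, `b` by `α`:
`λ_b ↦ λ_b - α λ_a`, `λ̃_a ↦ λ̃_a + α λ̃_b`, `η̃_a ↦ η̃_a + α η̃_b`. -/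
def shift (K : Kin n) (a b : Fin n) (α : ℂ) : Kin n where
  lam := Function.update K.lam b (K.lam b - α • K.lam a)
  lamt := Function.update K.lamt a (K.lamt a + α • K.lamt b)
  eta := Function.update K.eta a (K.eta a + α • K.eta b)

/-- Successive BCFW shifts, the head of the list first. -/
def shifts (K : Kin n) (l : List ((Fin n × Fin n) × ℂ)) : Kin n :=
  l.foldl (fun K b => K.shift b.1.1 b.1.2 b.2) K

end Kin

/-! ### The on-shell function -/

namespace BoxDiagram

/-- The bridges together with their parameters `α`. -/
def dressed (D : BoxDiagram m) (α : Fin D.bridges.length → ℂ) :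
    List ((Fin (m + 2) × Fin (m + 2)) × ℂ) :=
  List.ofFn fun I => (D.bridges.get I, α I)

/-- The shifted data after all bridges have been removed.  Its legs `p`, `q` are the internal
lines `\hat 1` and `\widehat{n-2}` attached to the box; `n - 1` and `n` are unshifted. -/
def hat (D : BoxDiagram m) (K : Kin (m + 2)) (α : Fin D.bridges.length → ℂ) : Kin (m + 2) :=
  K.shifts (D.dressed α)

/-- The legs outside the box. -/
abbrev Spectator (D : BoxDiagram m) : Type :=
  {i : Fin (m + 2) // i ≠ D.p ∧ i ≠ D.q ∧ i ≠ legA m ∧ i ≠ legB m}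

/-- The number of rows of the Grassmannian matrix of `D`. -/
def k (D : BoxDiagram m) : ℕ := 2 + D.unit.card

/-- The matrix `C₀` of the box and the dressed identity.  Two rows are the row vectors `λ` of the
four legs of the box; each leg `u` in `unit` has a row with the single entry `1` in column `u`. -/
noncomputable def seedMatrix (D : BoxDiagram m) (K : Kin (m + 2)) :
    Matrix (Fin D.k) (Fin (m + 2)) ℂ :=
  Matrix.of fun r i => Sum.elim
    (fun (x : Fin 2) =>
      if i = D.p ∨ i = D.q ∨ i = legA m ∨ i = legB m then K.lam i x else 0)
    (fun u => if i = D.unit.orderEmbOfFin rfl u then 1 else 0)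
    (finSumFinEquiv.symm r)

/-- The product `⋯ 𝓑(i₂, j₂; α₂) 𝓑(i₁, j₁; α₁)` of the bridge matrices of a list, the head of the
list being the factor on the right; `𝓑(i, j; α)` is the identity plus `α` in position `(i, j)`. -/
noncomputable def bridgeMatrix (l : List ((Fin (m + 2) × Fin (m + 2)) × ℂ)) :
    Matrix (Fin (m + 2)) (Fin (m + 2)) ℂ :=
  l.foldr (fun b M => M * Matrix.transvection b.1.1 b.1.2 b.2) 1

/-- The Grassmannian matrix that is left when the first `I` bridges have been removed,
`C₀` times the remaining bridge matrices. -/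
noncomputable def partialMatrix (D : BoxDiagram m) (K : Kin (m + 2))
    (α : Fin D.bridges.length → ℂ) (I : ℕ) : Matrix (Fin D.k) (Fin (m + 2)) ℂ :=
  D.seedMatrix (D.hat K α) * bridgeMatrix ((D.dressed α).drop I)

/-- The Grassmannian matrix `C = C₀ 𝓑 ⋯ 𝓑` of the diagram. -/
noncomputable def cMatrix (D : BoxDiagram m) (K : Kin (m + 2))
    (α : Fin D.bridges.length → ℂ) : Matrix (Fin D.k) (Fin (m + 2)) ℂ :=
  D.partialMatrix K α 0

/-- The arguments of the bosonic delta functions `δ(C·λ̃) δ(λ·C^⊥)` that are left when the overall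
`δ(∑ λ λ̃)` is split off: on `C = C₀ 𝓑 ⋯ 𝓑` they say that the shifted `λ̃ᵢ` vanishes for a leg
with a unit row in `C₀` and that the shifted `λᵢ` vanishes for a leg with a zero column. -/
noncomputable def deltaArg (D : BoxDiagram m) (K : Kin (m + 2)) (α : Fin D.bridges.length → ℂ)
    (i : D.Spectator) (x : Fin 2) : ℂ :=
  if (i : Fin (m + 2)) ∈ D.unit then (D.hat K α).lamt i x else (D.hat K α).lam i x

/-- The points (with all `α` nonzero) on which the delta functions are supported. -/
def support (D : BoxDiagram m) (K : Kin (m + 2)) : Set (Fin D.bridges.length → ℂ) :=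
  {α | (∀ I, α I ≠ 0) ∧ ∀ i x, D.deltaArg K α i x = 0}

/-- The fermionic delta function `δ^{k × 4}(C·η̃) = ∏_A ∏_r ∑_i C_{ri} η̃ᵢᴬ`. -/
noncomputable def fermionicDelta (D : BoxDiagram m) (K : Kin (m + 2))
    (α : Fin D.bridges.length → ℂ) : ExteriorAlgebra ℂ (OddSpace (m + 2)) :=
  (List.ofFn fun A : Fin 4 => (List.ofFn fun r : Fin D.k =>
    ExteriorAlgebra.ι ℂ (∑ i, D.cMatrix K α r i • K.eta i A)).prod).prod

/-- The Jacobian of the delta functions with respect to the parameters `α`.  An enumeration `e` of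
the delta functions by the bridges exists exactly if there are `2 n - 8` bridges; another
enumeration changes the Jacobian by a sign. -/
noncomputable def jacobian (D : BoxDiagram m) (e : Fin D.bridges.length ≃ D.Spectator × Fin 2)
    (K : Kin (m + 2)) (α : Fin D.bridges.length → ℂ) : ℂ :=
  Matrix.det (Matrix.of fun I J : Fin D.bridges.length =>
    deriv (fun t => D.deltaArg K (Function.update α J t) (e I).1 (e I).2) (α J))

/-- The denominator `⟨p q⟩⟨q n-1⟩⟨n-1 n⟩⟨n p⟩` of the four-point amplitude of the box. -/
def boxDenominator (D : BoxDiagram m) (K : Kin (m + 2)) : ℂ :=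
  K.angle D.p D.q * K.angle D.q (legA m) * K.angle (legA m) (legB m) * K.angle (legB m) D.p

/-- The Yangian invariant of the diagram, without the overall factor `δ(∑ λ λ̃)`:
`∫ ∏ dα / α` of the four-point amplitude of the box and the delta functions, evaluated on the
support of the delta functions. -/
noncomputable def yangian (D : BoxDiagram m) (e : Fin D.bridges.length ≃ D.Spectator × Fin 2)
    (K : Kin (m + 2)) : ExteriorAlgebra ℂ (OddSpace (m + 2)) :=
  ∑ᶠ α ∈ D.support K,
    ((∏ I, α I) * D.jacobian e K α * D.boxDenominator (D.hat K α))⁻¹ • D.fermionicDelta K α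

/-- The number of independent columns of `C` among those in `L`. -/
noncomputable def columnRank {k n : ℕ} (C : Matrix (Fin k) (Fin n) ℂ) (L : Finset (Fin n)) : ℕ :=
  (C.submatrix id (fun i : L => (i : Fin n))).rank

/-- The diagram with matrix `C` falls apart into a part with the external legs `L` and a part with
the other legs, joined by a single internal line. -/
def FactorsAlong {k n : ℕ} (C : Matrix (Fin k) (Fin n) ℂ) (L : Finset (Fin n)) : Prop :=
  columnRank C L + columnRank C Lᶜ = k + 1

end BoxDiagram

end OnShell

namespace OnShell

open Matrix

/-! ### Existence of a box diagram -/

namespace DecoratedPerm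

variable {n : ℕ}

/-! Existence is a descent: strip bridges until only a box is left. Removing a bridge preserves
`BoxCondition` and strictly lowers `∑ i * σ i` (`BridgeStep.sum_lt`). If no bridge can be removed,
`σ` is almost decreasing on the unfixed legs other than the last two. Since `σ` moves every leg
weakly to the right by at most `n`, this leaves just the preimages of the last two legs
(`isSeed_or_bridgeStep`).

No bridge touches the last two legs, so exchanging them commutes with all shifts. The support, the
Jacobian and the fermionic delta function are invariant, and only the cyclic order in the four-point
denominator changes. On the support the spectators carry no momentum; the box therefore obeys
four-particle momentum conservation, which turns the ratio of denominators into the ratio of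
Mandelstam variables (`Kin.s_div_s`).

For the recursion, a shift multiplies the `λ̃`-matrix by a transvection and the `λ`-matrix by its
inverse. At each stage the `λ`-plane thus lies in the row span of the remaining matrix and the
`λ̃`-plane is orthogonal to it. When the column spans of `L` and `Lᶜ` meet in a line, the momentum
flowing through that line has rank at most one (`FactorsAlong.det_sum_eq_zero`). -/

theorem image_eq_iff (σ : DecoratedPerm n) (i j : Fin n) :
    σ.image i = j ↔ σ.toFun i = j ∨ σ.toFun i = (j : ℕ) + n := by
  have h1 := σ.le_apply i
  have h2 := σ.apply_le i
  have hi := i.isLt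
  have hj := j.isLt
  rw [Fin.ext_iff]
  change σ.toFun i % n = j ↔ _
  constructor
  · intro h
    by_cases hlt : σ.toFun i < n
    · rw [Nat.mod_eq_of_lt hlt] at h
      exact Or.inl h
    · rw [Nat.mod_eq_sub_mod (by omega), Nat.mod_eq_of_lt (by omega)] at h
      omega
  · rintro (h | h) <;> rw [h]
    · exact Nat.mod_eq_of_lt hj
    · rw [Nat.add_mod_right, Nat.mod_eq_of_lt hj]

theorem image_injective (σ : DecoratedPerm n) : Function.Injective σ.image := fun i j h =>
  σ.inj (by simpa [image] using h)

theorem image_surjective (σ : DecoratedPerm n) : Function.Surjective σ.image :=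
  Finite.surjective_of_injective σ.image_injective

/-- The composition of a decorated permutation with a transposition of legs. -/
def compSwap (σ : DecoratedPerm n) (a b : Fin n)
    (h : ∀ i : Fin n, (i : ℕ) ≤ σ.toFun (Equiv.swap a b i) ∧
      σ.toFun (Equiv.swap a b i) ≤ (i : ℕ) + n) : DecoratedPerm n where
  toFun i := σ.toFun (Equiv.swap a b i)
  le_apply i := (h i).1
  apply_le i := (h i).2
  inj := σ.inj.comp (Equiv.swap a b).injective

end DecoratedPerm

variable {m : ℕ}

/-- A pair of neighbouring unfixed legs `a < b` with `σ a < σ b` carries a bridge, unless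
its removal exchanges the preimages of the last two legs. -/
theorem DecoratedPerm.BoxCondition.exists_bridgeStep {σ : DecoratedPerm (m + 2)}
    (hσ : σ.BoxCondition) {a b : Fin (m + 2)} (hab : a < b) (hb : b < legA m)
    (ha : σ.image a ≠ a) (hb' : σ.image b ≠ b) (hsep : ∀ c, a < c → c < b → σ.image c = c)
    (hlt : σ.toFun a < σ.toFun b) (hne : ¬ (σ.image a = legA m ∧ σ.image b = legB m)) :
    ∃ σ', BridgeStep σ a b σ' := by
  have hbA : (b : ℕ) < m := hb
  have hab' : (a : ℕ) < b := hab
  have hnot : ∀ i, (σ.image i ≠ i) → ¬ (a < i ∧ i < b) := fun i hi h => hi (hsep i h.1 h.2)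
  -- A fixed leg is its own only preimage, so no unfixed leg has its image strictly between `a` and
  -- `b`.
  have himg : ∀ i, σ.image i ≠ i → ¬ (a < σ.image i ∧ σ.image i < b) := fun i hi h =>
    hi (σ.image_injective (hsep _ h.1 h.2))
  have hbound : ∀ i, σ.image i ≠ i → ∀ c : Fin (m + 2), a < c → c < b →
      σ.toFun i ≠ c ∧ σ.toFun i ≠ (c : ℕ) + (m + 2) := by
    intro i hi c hac hcb
    have : σ.image i ≠ c := fun h => himg i hi (h ▸ ⟨hac, hcb⟩)
    rw [Ne, DecoratedPerm.image_eq_iff, not_or] at this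
    exact this
  have ha1 := σ.le_apply a
  have ha2 := σ.apply_le a
  have hb1 := σ.le_apply b
  have hb2 := σ.apply_le b
  have hafix := ha
  have hbfix := hb'
  rw [Ne, DecoratedPerm.image_eq_iff, not_or] at hafix hbfix
  -- The next two bounds are what keeps `σ'` a decorated permutation: `σ a` exceeds `a` and skips
  -- the fixed labels up to `b`; likewise `σ b` lies below `b + n` and skips those down to `a + n`.
  have h1 : (b : ℕ) ≤ σ.toFun a := by
    by_contra! h
    exact (hbound a ha ⟨σ.toFun a, by omega⟩ (Fin.lt_def.2 (by simp; omega))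
      (Fin.lt_def.2 (by simp; omega))).1 rfl
  have h2 : σ.toFun b ≤ (a : ℕ) + (m + 2) := by
    by_contra! h
    exact (hbound b hb' ⟨σ.toFun b - (m + 2), by omega⟩ (Fin.lt_def.2 (by simp; omega))
      (Fin.lt_def.2 (by simp; omega))).2 (by simp; omega)
  refine ⟨σ.compSwap a b fun i => ?_, hab, hb, hlt, hsep, fun i => rfl, ?_⟩
  · rw [Equiv.swap_apply_def]
    split_ifs with h h'
    · subst h; omega
    · subst h'; omega
    · exact ⟨σ.le_apply i, σ.apply_le i⟩
  · intro x y hx hy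
    change σ.image (Equiv.swap a b x) = _ at hx
    change σ.image (Equiv.swap a b y) = _ at hy
    generalize hx0 : Equiv.swap a b x = x0 at hx
    generalize hy0 : Equiv.swap a b y = y0 at hy
    have hxx : x = Equiv.swap a b x0 := by rw [← hx0, Equiv.swap_apply_self]
    have hyy : y = Equiv.swap a b y0 := by rw [← hy0, Equiv.swap_apply_self]
    have hxy := hσ.preimage_lt x0 y0 hx hy
    -- The preimages of the last two legs are unfixed, hence not strictly between `a` and `b`; the
    -- swap can reverse their order only if they are exactly `a` and `b`.
    have hnx := hnot x0 fun h => hσ.not_fixed_A (h.symm.trans hx ▸ h)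
    have hny := hnot y0 fun h => hσ.not_fixed_B (h.symm.trans hy ▸ h)
    have hne' : ¬ (x0 = a ∧ y0 = b) := by
      rintro ⟨rfl, rfl⟩
      exact hne ⟨hx, hy⟩
    rw [hxx, hyy, Equiv.swap_apply_def, Equiv.swap_apply_def]
    split_ifs <;> omega

theorem BridgeStep.image_eq {σ σ' : DecoratedPerm (m + 2)} {a b : Fin (m + 2)}
    (h : BridgeStep σ a b σ') (i : Fin (m + 2)) :
    σ'.image i = σ.image (Equiv.swap a b i) :=
  Fin.ext (by simp only [DecoratedPerm.image, h.swap_eq])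

theorem BridgeStep.lt_legB {σ σ' : DecoratedPerm (m + 2)} {a b : Fin (m + 2)}
    (h : BridgeStep σ a b σ') : b < legB m :=
  h.lt_legA.trans (Nat.lt_succ_self m)

theorem BridgeStep.boxCondition {σ σ' : DecoratedPerm (m + 2)} {a b : Fin (m + 2)}
    (h : BridgeStep σ a b σ') (hσ : σ.BoxCondition) : σ'.BoxCondition := by
  have hA : Equiv.swap a b (legA m) = legA m :=
    Equiv.swap_apply_of_ne_of_ne (h.lt.trans h.lt_legA).ne' h.lt_legA.ne'
  have hB : Equiv.swap a b (legB m) = legB m :=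
    Equiv.swap_apply_of_ne_of_ne (h.lt.trans h.lt_legB).ne' h.lt_legB.ne'
  constructor
  · rw [h.image_eq, hA]; exact hσ.not_fixed_A
  · rw [h.image_eq, hB]; exact hσ.not_fixed_B
  · rw [h.image_eq, hA]; exact hσ.image_A_ne
  · rw [h.swap_eq, h.swap_eq, hA, hB]; exact hσ.image_lt
  · exact h.ordered

/-- This is the rearrangement inequality for one transposition; it makes the removal of bridges
terminate. -/
theorem BridgeStep.sum_lt {σ σ' : DecoratedPerm (m + 2)} {a b : Fin (m + 2)}
    (h : BridgeStep σ a b σ') :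
    ∑ i : Fin (m + 2), (i : ℕ) * σ'.toFun i < ∑ i : Fin (m + 2), (i : ℕ) * σ.toFun i := by
  have hab : a ≠ b := h.lt.ne
  have key : ∀ f : Fin (m + 2) → ℕ,
      ∑ i, f i = (f a + f b) + ∑ i ∈ (Finset.univ.erase a).erase b, f i := by
    intro f
    rw [add_assoc, Finset.add_sum_erase _ _ (by simp [hab.symm]),
      Finset.add_sum_erase _ _ (Finset.mem_univ _)]
  rw [key, key fun i => (i : ℕ) * σ.toFun i]
  have hrest : ∑ i ∈ (Finset.univ.erase a).erase b, (i : ℕ) * σ'.toFun i =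
      ∑ i ∈ (Finset.univ.erase a).erase b, (i : ℕ) * σ.toFun i := by
    refine Finset.sum_congr rfl fun i hi => ?_
    simp only [Finset.mem_erase, Finset.mem_univ, and_true] at hi
    rw [h.swap_eq, Equiv.swap_apply_of_ne_of_ne hi.2 hi.1]
  rw [hrest, h.swap_eq, h.swap_eq, Equiv.swap_apply_left, Equiv.swap_apply_right]
  have h1 : (a : ℕ) < b := h.lt
  have h2 := h.apply_lt
  obtain ⟨u, hu⟩ := Nat.exists_eq_add_of_lt h1
  obtain ⟨v, hv⟩ := Nat.exists_eq_add_of_lt h2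
  rw [hu, hv]
  refine Nat.add_lt_add_right ?_ _
  -- The two sides differ by `(b - a) * (σ b - σ a) = (u + 1) * (v + 1)`.
  nlinarith

/-- The preimages of the last two legs lie among the other legs. -/
theorem DecoratedPerm.BoxCondition.exists_preimages {σ : DecoratedPerm (m + 2)}
    (hσ : σ.BoxCondition) :
    ∃ x y : Fin (m + 2), x < y ∧ (y : ℕ) < m ∧ σ.toFun x = m ∧ σ.toFun y = m + 1 := by
  obtain ⟨x, hx⟩ := σ.image_surjective (legA m)
  obtain ⟨y, hy⟩ := σ.image_surjective (legB m)
  have hxy := hσ.preimage_lt x y hx hy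
  have hyA : (y : ℕ) ≠ m := fun h => hσ.image_A_ne (by
    rw [show legA m = y from Fin.ext h.symm, hy])
  have hyB : (y : ℕ) ≠ m + 1 := fun h => hσ.not_fixed_B (by
    nth_rewrite 1 [show legB m = y from Fin.ext h.symm]; exact hy)
  have hy2 := y.isLt
  have hxy' : (x : ℕ) < y := hxy
  have h1 := σ.apply_le x
  have h2 := σ.apply_le y
  rw [DecoratedPerm.image_eq_iff] at hx hy
  have hA : (legA m : ℕ) = m := rfl
  have hB : (legB m : ℕ) = m + 1 := rfl
  exact ⟨x, y, hxy, by omega, by omega, by omega⟩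

/-- If the unfixed legs below the last two are just the preimages of the last two, then `σ` is the
permutation of a box with a dressed identity. -/
theorem DecoratedPerm.BoxCondition.exists_isSeed {σ : DecoratedPerm (m + 2)}
    (hσ : σ.BoxCondition) {x y : Fin (m + 2)} (hxy : x < y) (hy : (y : ℕ) < m)
    (hx' : σ.toFun x = m) (hy' : σ.toFun y = m + 1)
    (hfix : ∀ i : Fin (m + 2), (i : ℕ) < m → i ≠ x → i ≠ y → σ.image i = i) :
    ∃ D : BoxDiagram m, D.IsSeed σ := by
  have hAv : (legA m : ℕ) = m := rfl
  have hBv : (legB m : ℕ) = m + 1 := rfl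
  have hxy' : (x : ℕ) < y := hxy
  have hxi : σ.image x = legA m := (σ.image_eq_iff _ _).2 (Or.inl hx')
  have hyi : σ.image y = legB m := (σ.image_eq_iff _ _).2 (Or.inl hy')
  -- The last two labels are the images of `x` and `y`, and every other label below `m` is its own
  -- image, so only `x` and `y` are left for the last two legs. As `σ` never decreases, the value is
  -- the one raised by `n`; `image_lt` then settles which leg gets which.
  have key : ∀ l : Fin (m + 2), m ≤ (l : ℕ) →
      σ.toFun l = (x : ℕ) + (m + 2) ∨ σ.toFun l = (y : ℕ) + (m + 2) := by
    intro l hl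
    have h1 : σ.image l ≠ legA m := by
      rw [← hxi]
      exact fun h => by have := congrArg Fin.val (σ.image_injective h); omega
    have h2 : σ.image l ≠ legB m := by
      rw [← hyi]
      exact fun h => by have := congrArg Fin.val (σ.image_injective h); omega
    have h3 : (σ.image l : ℕ) < m := by
      have := (σ.image l).isLt
      rw [Ne, Fin.ext_iff] at h1 h2
      omega
    have h4 : σ.image l = x ∨ σ.image l = y := by
      by_contra! h
      have := congrArg Fin.val (σ.image_injective (hfix _ h3 h.1 h.2))
      omega
    have h5 := σ.le_apply l
    rw [DecoratedPerm.image_eq_iff, DecoratedPerm.image_eq_iff] at h4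
    omega
  have hA := key (legA m) le_rfl
  have hB := key (legB m) (Nat.le_succ m)
  have hlt := hσ.image_lt
  refine ⟨⟨x, y, hxy, hy, Finset.univ.filter fun i => (i ≠ x ∧ i ≠ y ∧ i ≠ legA m ∧ i ≠ legB m) ∧
    σ.toFun i = (i : ℕ) + (m + 2), fun i hi => (Finset.mem_filter.1 hi).2.1, []⟩,
    hx', hy', by dsimp only; omega, by dsimp only; omega,
    fun i hi => (Finset.mem_filter.1 hi).2.2, fun i hi h1 h2 h3 h4 => ?_⟩
  simp only [Finset.mem_filter, Finset.mem_univ, true_and, not_and] at hi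
  have h5 := hi ⟨h1, h2, h3, h4⟩
  have h6 := hfix i (by
    have := i.isLt
    rw [Ne, Fin.ext_iff] at h3 h4
    omega) h1 h2
  rw [DecoratedPerm.image_eq_iff] at h6
  exact h6.resolve_right h5

/-- Without a removable bridge, `σ` cannot increase between neighbouring unfixed legs below the last
two, except on the protected pair of preimages. Comparing the first and the last of these legs
squeezes all values to those of that pair. -/
theorem DecoratedPerm.BoxCondition.isSeed_or_bridgeStep {σ : DecoratedPerm (m + 2)}
    (hσ : σ.BoxCondition) :
    (∃ D : BoxDiagram m, D.IsSeed σ) ∨ ∃ a b σ', BridgeStep σ a b σ' := by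
  refine or_iff_not_imp_right.2 fun hstep => ?_
  obtain ⟨x, y, hxy, hy, hx', hy'⟩ := hσ.exists_preimages
  have hxy' : (x : ℕ) < y := hxy
  refine hσ.exists_isSeed hxy hy hx' hy' ?_
  -- Identifying the values `m` and `m + 1` makes the protected pair harmless: `τ` is antitone on
  -- `N` without exception.
  let τ : Fin (m + 2) → ℕ := fun i => if σ.toFun i = m + 1 then m else σ.toFun i
  let N : Finset (Fin (m + 2)) := Finset.univ.filter fun i => (i : ℕ) < m ∧ σ.image i ≠ i
  have hN : ∀ i, i ∈ N ↔ (i : ℕ) < m ∧ σ.image i ≠ i := fun i => by simp [N]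
  have hNimg : ∀ i ∈ N, (σ.image i : ℕ) < m → σ.image i ∈ N := fun i hi h =>
    (hN _).2 ⟨h, fun h' => ((hN i).1 hi).2 (σ.image_injective h')⟩
  have hadj : ∀ a ∈ N, ∀ b ∈ N, a < b → (∀ c, a < c → c < b → c ∉ N) → τ b ≤ τ a := by
    intro a ha b hb hab hsep
    rw [hN] at ha hb
    by_cases hlt : σ.toFun a < σ.toFun b
    · by_cases hne : σ.image a = legA m ∧ σ.image b = legB m
      · have h1 := (σ.image_eq_iff _ _).1 hne.1
        have h2 := (σ.image_eq_iff _ _).1 hne.2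
        have hAv : (legA m : ℕ) = m := rfl
        have hBv : (legB m : ℕ) = m + 1 := rfl
        have h3 := σ.apply_le a
        have h4 := σ.apply_le b
        have h5 : σ.toFun a = m := by omega
        have h6 : σ.toFun b = m + 1 := by omega
        simp [τ, h5, h6]
      · refine absurd ⟨a, b, hσ.exists_bridgeStep hab hb.1 ha.2 hb.2 (fun c hac hcb => ?_)
          hlt hne⟩ hstep
        by_contra hc
        exact hsep c hac hcb ((hN c).2 ⟨lt_trans (Fin.lt_def.1 hcb) hb.1, hc⟩)
    · simp only [τ]
      split_ifs <;> omega
  have hanti : ∀ d : ℕ, ∀ a ∈ N, ∀ b ∈ N, a ≤ b → (b : ℕ) - a = d → τ b ≤ τ a := by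
    intro d
    induction d using Nat.strong_induction_on with
    | _ d ih =>
      intro a ha b hb hab hd
      rcases hab.eq_or_lt with rfl | hab
      · exact le_rfl
      · by_cases hc : ∃ c, a < c ∧ c < b ∧ c ∈ N
        · obtain ⟨c, hac, hcb, hc⟩ := hc
          have h1 : (a : ℕ) < c := hac
          have h2 : (c : ℕ) < b := hcb
          exact (ih _ (by omega) c hc b hb hcb.le rfl).trans
            (ih _ (by omega) a ha c hc hac.le rfl)
        · push Not at hc
          exact hadj a ha b hb hab hc
  have hxN : x ∈ N := (hN x).2 ⟨by omega, fun h => by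
    rw [DecoratedPerm.image_eq_iff] at h; omega⟩
  have hτx : τ x = m := by simp [τ, hx']
  have hmin := N.min'_mem ⟨x, hxN⟩
  have hmax := N.max'_mem ⟨x, hxN⟩
  set u := N.min' ⟨x, hxN⟩ with hu
  set v := N.max' ⟨x, hxN⟩ with hv
  -- Otherwise `σ u` wraps around, and its image is an unfixed leg at most `u`; minimality would
  -- make `u` fixed.
  have hτv : τ u ≤ m := by
    by_contra! h
    have h1 : m + 2 ≤ σ.toFun u := by
      simp only [τ] at h
      split_ifs at h <;> omega
    have h2 := σ.apply_le u
    have h3 := (hN u).1 hmin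
    have h4 : σ.image u = ⟨σ.toFun u - (m + 2), by omega⟩ :=
      (σ.image_eq_iff _ _).2 (Or.inr (by simp; omega))
    have h5 : (σ.image u : ℕ) = σ.toFun u - (m + 2) := congrArg Fin.val h4
    have h6 : u ≤ σ.image u := N.min'_le _ (hNimg u hmin (by omega))
    exact h3.2 (le_antisymm (Fin.le_def.2 (by omega)) h6)
  have hall : ∀ i ∈ N, τ i ≤ m := fun i hi =>
    (hanti _ u hmin i hi (N.min'_le i hi) rfl).trans hτv
  -- Dually, the image of `v` would be an unfixed leg at least `v`, so maximality would make `v`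
  -- fixed.
  have hτu : m ≤ τ v := by
    by_contra! h
    have h1 : σ.toFun v < m := by
      simp only [τ] at h
      split_ifs at h <;> omega
    have h2 := σ.le_apply v
    have h3 := (hN v).1 hmax
    have h4 : σ.image v = ⟨σ.toFun v, by omega⟩ :=
      (σ.image_eq_iff _ _).2 (Or.inl (by simp))
    have h5 : (σ.image v : ℕ) = σ.toFun v := congrArg Fin.val h4
    have h6 : σ.image v ≤ v := N.le_max' _ (hNimg v hmax (by omega))
    exact h3.2 (le_antisymm h6 (Fin.le_def.2 (by omega)))
  intro i hi hix hiy
  by_contra hfix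
  have hiN := (hN i).2 ⟨hi, hfix⟩
  have h1 : τ i = m :=
    le_antisymm (hall i hiN) (hτu.trans (hanti _ i hiN v hmax (N.le_max' i hiN) rfl))
  have h2 : σ.toFun i = m ∨ σ.toFun i = m + 1 := by
    simp only [τ] at h1
    split_ifs at h1 <;> omega
  rcases h2 with h2 | h2
  · exact hix (σ.inj (by simp only [h2, hx']))
  · exact hiy (σ.inj (by simp only [h2, hy']))

/-- A chain reads only the box and the unit set of `D`, so the list found by the descent may be
installed afterwards as its bridges. -/
theorem BoxDiagram.IsBridgeChain.withBridges {D : BoxDiagram m} {σ : DecoratedPerm (m + 2)}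
    {l : List (Fin (m + 2) × Fin (m + 2))} (h : D.IsBridgeChain σ l)
    (l' : List (Fin (m + 2) × Fin (m + 2))) :
    BoxDiagram.IsBridgeChain { D with bridges := l' } σ l := by
  induction h with
  | seed σ h =>
    exact .seed σ ⟨h.apply_p, h.apply_q, h.apply_A, h.apply_B, h.apply_unit, h.apply_zero⟩
  | bridge σ σ' a b l hs _ ih => exact .bridge σ σ' a b l hs ih

theorem DecoratedPerm.BoxCondition.exists_represents {σ : DecoratedPerm (m + 2)}
    (hσ : σ.BoxCondition) : ∃ D : BoxDiagram m, D.Represents σ := by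
  suffices h : ∀ (N : ℕ) (σ : DecoratedPerm (m + 2)), σ.BoxCondition →
      ∑ i : Fin (m + 2), (i : ℕ) * σ.toFun i = N →
      ∃ (D : BoxDiagram m) (l : _), D.IsBridgeChain σ l by
    obtain ⟨D, l, h⟩ := h _ σ hσ rfl
    exact ⟨_, h.withBridges l⟩
  intro N
  induction N using Nat.strong_induction_on with
  | _ N ih =>
    intro σ hσ hN
    rcases hσ.isSeed_or_bridgeStep with ⟨D, hD⟩ | ⟨a, b, σ', h⟩
    · exact ⟨D, [], .seed σ hD⟩
    · obtain ⟨D, l, hl⟩ := ih _ (hN ▸ h.sum_lt) σ' (h.boxCondition hσ) rfl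
      exact ⟨D, _, .bridge σ σ' a b l h hl⟩

/-! ### The number of rows -/

theorem BridgeStep.k_eq {σ σ' : DecoratedPerm (m + 2)} {a b : Fin (m + 2)}
    (h : BridgeStep σ a b σ') : σ'.k = σ.k := by
  refine Finset.card_bij (fun i _ => Equiv.swap a b i) ?_ ?_ ?_
  · intro i hi
    simpa [h.swap_eq] using hi
  · intro i _ j _ hij
    exact (Equiv.swap a b).injective hij
  · intro j hj
    exact ⟨Equiv.swap a b j, by simpa [h.swap_eq] using hj, Equiv.swap_apply_self ..⟩

theorem BoxDiagram.IsSeed.k_eq {D : BoxDiagram m} {σ : DecoratedPerm (m + 2)}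
    (h : D.IsSeed σ) : D.k = σ.k := by
  have hAv : (legA m : ℕ) = m := rfl
  have hBv : (legB m : ℕ) = m + 1 := rfl
  have hAB : legA m ≠ legB m := fun h => by have := congrArg Fin.val h; omega
  have hset : (Finset.univ.filter fun i => m + 2 ≤ σ.toFun i) =
      insert (legA m) (insert (legB m) D.unit) := by
    ext i
    simp only [Finset.mem_filter, Finset.mem_univ, true_and, Finset.mem_insert]
    constructor
    · intro hi
      by_contra! hcon
      by_cases hp : i = D.p
      · subst hp; rw [h.apply_p] at hi; omega
      by_cases hq : i = D.q
      · subst hq; rw [h.apply_q] at hi; omega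
      rw [h.apply_zero i hcon.2.2 hp hq hcon.1 hcon.2.1] at hi
      have := i.isLt
      omega
    · rintro (rfl | rfl | hi)
      · rw [h.apply_A]; omega
      · rw [h.apply_B]; omega
      · rw [h.apply_unit i hi]; omega
  rw [DecoratedPerm.k, hset, Finset.card_insert_of_notMem, Finset.card_insert_of_notMem,
    BoxDiagram.k]
  · omega
  · exact fun hB => (D.unit_spec _ hB).2.2.2 rfl
  · rw [Finset.mem_insert, not_or]
    exact ⟨hAB, fun hA => (D.unit_spec _ hA).2.2.1 rfl⟩

theorem BoxDiagram.IsBridgeChain.k_eq {D : BoxDiagram m} {σ : DecoratedPerm (m + 2)}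
    {l : List (Fin (m + 2) × Fin (m + 2))} (h : D.IsBridgeChain σ l) : D.k = σ.k := by
  induction h with
  | seed σ h => exact h.k_eq
  | bridge σ σ' a b l hs _ ih => rw [ih, hs.k_eq]

theorem BoxDiagram.IsBridgeChain.lt_of_mem {D : BoxDiagram m} {σ : DecoratedPerm (m + 2)}
    {l : List (Fin (m + 2) × Fin (m + 2))} (h : D.IsBridgeChain σ l) :
    ∀ b ∈ l, b.1 < b.2 ∧ b.2 < legA m := by
  induction h with
  | seed => simp
  | bridge σ σ' a b l hs _ ih => simpa using ⟨⟨hs.lt, hs.lt_legA⟩, by simpa using ih⟩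


/-! ### Shifts as products with transvections -/

namespace Kin

variable {n : ℕ}

/-- The spinors `λᵢ` as the columns of a matrix. -/
def lamMatrix (K : Kin n) : Matrix (Fin 2) (Fin n) ℂ := Matrix.of fun x i => K.lam i x

/-- The spinors `λ̃ᵢ` as the rows of a matrix. -/
def lamtMatrix (K : Kin n) : Matrix (Fin n) (Fin 2) ℂ := Matrix.of fun i x => K.lamt i x

theorem sum_mom (K : Kin n) : ∑ i, K.mom i = K.lamMatrix * K.lamtMatrix := by
  ext x y
  simp [Matrix.sum_apply, mom, vecMulVec_apply, mul_apply, lamMatrix, lamtMatrix]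

theorem s_eq (K : Kin n) (i j : Fin n) :
    K.s i j = K.angle i j * (K.lamt i 0 * K.lamt j 1 - K.lamt i 1 * K.lamt j 0) := by
  simp only [s, mom, angle, det_fin_two, Matrix.add_apply, vecMulVec_apply]
  ring

theorem angle_swap (K : Kin n) (i j : Fin n) : K.angle i j = - K.angle j i := by
  simp only [angle]
  ring

theorem shifts_cons (K : Kin n) (b : (Fin n × Fin n) × ℂ) (l : List ((Fin n × Fin n) × ℂ)) :
    K.shifts (b :: l) = (K.shift b.1.1 b.1.2 b.2).shifts l := rfl

theorem shifts_append (K : Kin n) (l l' : List ((Fin n × Fin n) × ℂ)) :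
    K.shifts (l ++ l') = (K.shifts l).shifts l' := List.foldl_append

/-- Here the transvection undoes the shift, whereas in `lamtMatrix_shift` it performs it; it cancels
in the product of the two matrices, which is the total momentum. -/
theorem lamMatrix_shift (K : Kin n) {a b : Fin n} (hab : a ≠ b) (α : ℂ) :
    (K.shift a b α).lamMatrix * transvection a b α = K.lamMatrix := by
  ext x i
  rw [transvection, Matrix.mul_add, Matrix.mul_one, Matrix.add_apply]
  by_cases hi : i = b
  · subst hi
    rw [mul_single_apply_same]
    simp [lamMatrix, shift, hab]
    ring
  · rw [mul_single_apply_of_ne _ _ _ _ _ hi]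
    simp [lamMatrix, shift, hi]

theorem lamtMatrix_shift (K : Kin n) (a b : Fin n) (α : ℂ) :
    (K.shift a b α).lamtMatrix = transvection a b α * K.lamtMatrix := by
  ext i x
  rw [transvection, Matrix.add_mul, Matrix.one_mul, Matrix.add_apply]
  by_cases hi : i = a
  · subst hi
    rw [single_mul_apply_same]
    simp [lamtMatrix, shift]
  · rw [single_mul_apply_of_ne _ _ _ _ _ hi]
    simp [lamtMatrix, shift, hi]

theorem shift_relabel (K : Kin n) {π : Equiv.Perm (Fin n)} {a b : Fin n} (ha : π a = a)
    (hb : π b = b) (α : ℂ) : (K.relabel π).shift a b α = (K.shift a b α).relabel π := by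
  have key : ∀ {β : Type} (f : Fin n → β) (c : Fin n) (v : β), π c = c →
      Function.update (fun i => f (π i)) c v = fun i => Function.update f c v (π i) := by
    intro β f c v hc
    funext i
    by_cases hi : i = c
    · subst hi; simp [hc]
    · have hi' : π i ≠ c := fun h => hi (π.injective (h.trans hc.symm))
      simp [hi, hi']
  simp only [shift, relabel, key _ _ _ ha, key _ _ _ hb, ha, hb]

theorem shifts_relabel (K : Kin n) {π : Equiv.Perm (Fin n)} (l : List ((Fin n × Fin n) × ℂ))
    (h : ∀ b ∈ l, π b.1.1 = b.1.1 ∧ π b.1.2 = b.1.2) :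
    (K.relabel π).shifts l = (K.shifts l).relabel π := by
  induction l generalizing K with
  | nil => rfl
  | cons b l ih =>
    have hb := h b (by simp)
    rw [shifts_cons, shifts_cons, shift_relabel K hb.1 hb.2, ih _ fun c hc => h c (by simp [hc])]

theorem mom_shifts_of_ne (K : Kin n) (i : Fin n) (l : List ((Fin n × Fin n) × ℂ))
    (h : ∀ b ∈ l, i ≠ b.1.1 ∧ i ≠ b.1.2) : (K.shifts l).mom i = K.mom i := by
  induction l generalizing K with
  | nil => rfl
  | cons b l ih =>
    have hb := h b (by simp)
    rw [shifts_cons, ih _ fun c hc => h c (by simp [hc])]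
    simp [mom, shift, hb.1, hb.2]

/-- A shift changes only the momenta of `a` and `b`, and `b` is outside `L`. -/
theorem sum_mom_shift (K : Kin n) {a b : Fin n} (α : ℂ) {L : Finset (Fin n)} (ha : a ∈ L)
    (hb : b ∉ L) :
    ∑ i ∈ L, (K.shift a b α).mom i = ∑ i ∈ L, K.mom i + α • vecMulVec (K.lam a) (K.lamt b) := by
  have hab : a ≠ b := fun h => hb (h ▸ ha)
  have key : ∀ i ∈ L, (K.shift a b α).mom i =
      K.mom i + if i = a then α • vecMulVec (K.lam a) (K.lamt b) else 0 := by
    intro i hi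
    have hib : i ≠ b := fun h => hb (h ▸ hi)
    split_ifs with h
    · subst h
      simp [mom, shift, hab, vecMulVec_add, vecMulVec_smul]
    · simp [mom, shift, hib, h]
  rw [Finset.sum_congr rfl key, Finset.sum_add_distrib, Finset.sum_ite_eq' L a, if_pos ha]

end Kin

namespace BoxDiagram

theorem bridgeMatrix_cons (b : (Fin (m + 2) × Fin (m + 2)) × ℂ)
    (l : List ((Fin (m + 2) × Fin (m + 2)) × ℂ)) :
    bridgeMatrix (b :: l) = bridgeMatrix l * transvection b.1.1 b.1.2 b.2 := rfl

theorem lamMatrix_shifts (K : Kin (m + 2)) (l : List ((Fin (m + 2) × Fin (m + 2)) × ℂ))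
    (h : ∀ b ∈ l, b.1.1 ≠ b.1.2) :
    (K.shifts l).lamMatrix * bridgeMatrix l = K.lamMatrix := by
  induction l generalizing K with
  | nil => exact Matrix.mul_one _
  | cons b l ih =>
    rw [Kin.shifts_cons, bridgeMatrix_cons, ← Matrix.mul_assoc,
      ih _ fun c hc => h c (by simp [hc]), Kin.lamMatrix_shift _ (h b (by simp))]

theorem lamtMatrix_shifts (K : Kin (m + 2)) (l : List ((Fin (m + 2) × Fin (m + 2)) × ℂ)) :
    (K.shifts l).lamtMatrix = bridgeMatrix l * K.lamtMatrix := by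
  induction l generalizing K with
  | nil => exact (Matrix.one_mul _).symm
  | cons b l ih =>
    rw [Kin.shifts_cons, bridgeMatrix_cons, ih, Kin.lamtMatrix_shift, Matrix.mul_assoc]

theorem sum_mom_shifts (K : Kin (m + 2)) (l : List ((Fin (m + 2) × Fin (m + 2)) × ℂ))
    (h : ∀ b ∈ l, b.1.1 ≠ b.1.2) : ∑ i, (K.shifts l).mom i = ∑ i, K.mom i := by
  rw [Kin.sum_mom, Kin.sum_mom, ← lamMatrix_shifts K l h, lamtMatrix_shifts, Matrix.mul_assoc]

theorem det_bridgeMatrix (l : List ((Fin (m + 2) × Fin (m + 2)) × ℂ))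
    (h : ∀ b ∈ l, b.1.1 ≠ b.1.2) : (bridgeMatrix l).det = 1 := by
  induction l with
  | nil => exact det_one
  | cons b l ih =>
    rw [bridgeMatrix_cons, det_mul, ih fun c hc => h c (by simp [hc]),
      det_transvection_of_ne _ _ (h b (by simp)), one_mul]

theorem bridgeMatrix_submatrix {π : Equiv.Perm (Fin (m + 2))}
    (l : List ((Fin (m + 2) × Fin (m + 2)) × ℂ))
    (h : ∀ b ∈ l, π b.1.1 = b.1.1 ∧ π b.1.2 = b.1.2) :
    (bridgeMatrix l).submatrix π π = bridgeMatrix l := by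
  induction l with
  | nil => exact submatrix_one_equiv π
  | cons b l ih =>
    obtain ⟨h1, h2⟩ := h b (by simp)
    have hT : (transvection b.1.1 b.1.2 b.2).submatrix π π = transvection b.1.1 b.1.2 b.2 := by
      have e1 : ∀ i, b.1.1 = π i ↔ b.1.1 = i := fun i => by
        nth_rewrite 1 [← h1]; exact π.injective.eq_iff
      have e2 : ∀ i, b.1.2 = π i ↔ b.1.2 = i := fun i => by
        nth_rewrite 1 [← h2]; exact π.injective.eq_iff
      ext i j
      simp [transvection, single_apply, one_apply, e1, e2]
    rw [bridgeMatrix_cons, ← submatrix_mul_equiv _ _ π π π, ih fun c hc => h c (by simp [hc]), hT]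

/-! ### Exchanging the last two legs -/

variable {D : BoxDiagram m}

theorem mem_dressed {α : Fin D.bridges.length → ℂ} {b : (Fin (m + 2) × Fin (m + 2)) × ℂ}
    (hb : b ∈ D.dressed α) : b.1 ∈ D.bridges := by
  rw [dressed, List.mem_ofFn] at hb
  obtain ⟨I, rfl⟩ := hb
  exact List.get_mem _ _

/-- The bridges of `D` connect legs `a < b` different from the last two. -/
def Proper (D : BoxDiagram m) : Prop := ∀ b ∈ D.bridges, b.1 < b.2 ∧ b.2 < legA m

theorem Represents.proper {σ : DecoratedPerm (m + 2)} (h : D.Represents σ) : D.Proper :=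
  IsBridgeChain.lt_of_mem h

theorem legA_lt_legB : legA m < legB m := Nat.lt_succ_self m

theorem Proper.ne (h : D.Proper) {α : Fin D.bridges.length → ℂ} :
    ∀ b ∈ D.dressed α, b.1.1 ≠ b.1.2 := fun b hb => (h b.1 (mem_dressed hb)).1.ne

theorem Proper.ne_legA (h : D.Proper) {α : Fin D.bridges.length → ℂ} :
    ∀ b ∈ D.dressed α, legA m ≠ b.1.1 ∧ legA m ≠ b.1.2 := fun b hb =>
  have hb := h b.1 (mem_dressed hb)
  ⟨(hb.1.trans hb.2).ne', hb.2.ne'⟩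

theorem Proper.ne_legB (h : D.Proper) {α : Fin D.bridges.length → ℂ} :
    ∀ b ∈ D.dressed α, legB m ≠ b.1.1 ∧ legB m ≠ b.1.2 := fun b hb =>
  have hb := h b.1 (mem_dressed hb)
  ⟨(hb.1.trans (hb.2.trans legA_lt_legB)).ne', (hb.2.trans legA_lt_legB).ne'⟩

theorem Proper.swap_eq (h : D.Proper) {α : Fin D.bridges.length → ℂ} :
    ∀ b ∈ D.dressed α, Equiv.swap (legA m) (legB m) b.1.1 = b.1.1 ∧
      Equiv.swap (legA m) (legB m) b.1.2 = b.1.2 := fun b hb =>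
  have hA := h.ne_legA b hb
  have hB := h.ne_legB b hb
  ⟨Equiv.swap_apply_of_ne_of_ne hA.1.symm hB.1.symm,
    Equiv.swap_apply_of_ne_of_ne hA.2.symm hB.2.symm⟩

theorem swap_p : Equiv.swap (legA m) (legB m) D.p = D.p :=
  Equiv.swap_apply_of_ne_of_ne (D.p_lt_q.trans D.q_lt).ne
    (D.p_lt_q.trans (D.q_lt.trans legA_lt_legB)).ne

theorem swap_q : Equiv.swap (legA m) (legB m) D.q = D.q :=
  Equiv.swap_apply_of_ne_of_ne D.q_lt.ne (D.q_lt.trans legA_lt_legB).ne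

theorem Proper.hat_relabel (h : D.Proper) (K : Kin (m + 2)) (α : Fin D.bridges.length → ℂ) :
    D.hat (K.relabel (Equiv.swap (legA m) (legB m))) α =
      (D.hat K α).relabel (Equiv.swap (legA m) (legB m)) :=
  K.shifts_relabel _ h.swap_eq

/-- The delta functions involve spectators only. The equality is one of functions of `α`, so it
carries over to the support and to the derivatives in the Jacobian. -/
theorem Proper.deltaArg_relabel (h : D.Proper) (K : Kin (m + 2)) :
    D.deltaArg (K.relabel (Equiv.swap (legA m) (legB m))) = D.deltaArg K := by
  funext α i x
  have hi : Equiv.swap (legA m) (legB m) i = i :=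
    Equiv.swap_apply_of_ne_of_ne i.2.2.2.1 i.2.2.2.2
  simp only [deltaArg, h.hat_relabel]
  simp only [Kin.relabel, hi]

theorem Proper.support_relabel (h : D.Proper) (K : Kin (m + 2)) :
    D.support (K.relabel (Equiv.swap (legA m) (legB m))) = D.support K := by
  simp only [support, h.deltaArg_relabel]

theorem Proper.jacobian_relabel (h : D.Proper) (e : Fin D.bridges.length ≃ D.Spectator × Fin 2)
    (K : Kin (m + 2)) (α : Fin D.bridges.length → ℂ) :
    D.jacobian e (K.relabel (Equiv.swap (legA m) (legB m))) α = D.jacobian e K α := by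
  simp only [jacobian, h.deltaArg_relabel]

/-- The box rows do not see the cyclic order of the box legs: each column there is just the spinor
of its leg. -/
theorem seedMatrix_relabel (K : Kin (m + 2)) :
    D.seedMatrix (K.relabel (Equiv.swap (legA m) (legB m))) =
      (D.seedMatrix K).submatrix id (Equiv.swap (legA m) (legB m)) := by
  have hfix : ∀ i j, Equiv.swap (legA m) (legB m) j = j →
      (Equiv.swap (legA m) (legB m) i = j ↔ i = j) := fun i j hj => by
    nth_rewrite 1 [← hj]; exact (Equiv.swap (legA m) (legB m)).injective.eq_iff
  have hA : ∀ i, Equiv.swap (legA m) (legB m) i = legA m ↔ i = legB m := fun i => by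
    rw [Equiv.swap_apply_eq_iff, Equiv.swap_apply_left]
  have hB : ∀ i, Equiv.swap (legA m) (legB m) i = legB m ↔ i = legA m := fun i => by
    rw [Equiv.swap_apply_eq_iff, Equiv.swap_apply_right]
  ext r i
  simp only [seedMatrix, of_apply, submatrix_apply, id]
  rcases finSumFinEquiv.symm r with x | u
  · simp only [Sum.elim_inl, Kin.relabel, hfix i _ swap_p, hfix i _ swap_q, hA, hB,
      or_comm (a := i = legB m)]
  · have hu := D.unit_spec _ (D.unit.orderEmbOfFin_mem rfl u)
    simp only [Sum.elim_inr, hfix i _ (Equiv.swap_apply_of_ne_of_ne hu.2.2.1 hu.2.2.2)]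

theorem Proper.cMatrix_relabel (h : D.Proper) (K : Kin (m + 2)) (α : Fin D.bridges.length → ℂ) :
    D.cMatrix (K.relabel (Equiv.swap (legA m) (legB m))) α =
      (D.cMatrix K α).submatrix id (Equiv.swap (legA m) (legB m)) := by
  rw [cMatrix, cMatrix, partialMatrix, partialMatrix, List.drop_zero, h.hat_relabel,
    seedMatrix_relabel, ← submatrix_mul_equiv _ _ id (Equiv.swap (legA m) (legB m)) _,
    bridgeMatrix_submatrix _ h.swap_eq]

/-- The columns of `C` and the `η̃ᵢ` are permuted together, which only reorders each sum over legs.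
-/
theorem Proper.fermionicDelta_relabel (h : D.Proper) (K : Kin (m + 2))
    (α : Fin D.bridges.length → ℂ) :
    D.fermionicDelta (K.relabel (Equiv.swap (legA m) (legB m))) α = D.fermionicDelta K α := by
  simp only [fermionicDelta, h.cMatrix_relabel, submatrix_apply, id]
  congr 2
  funext A
  congr 2
  funext r
  congr 1
  exact Equiv.sum_comp (Equiv.swap (legA m) (legB m)) fun i => D.cMatrix K α r i • K.eta i A

theorem yangian_of_support (e : Fin D.bridges.length ≃ D.Spectator × Fin 2) {K : Kin (m + 2)}
    {α : Fin D.bridges.length → ℂ} (h : D.support K = {α}) :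
    D.yangian e K = ((∏ I, α I) * D.jacobian e K α * D.boxDenominator (D.hat K α))⁻¹ •
      D.fermionicDelta K α := by
  rw [yangian, h, finsum_mem_singleton]

theorem boxDenominator_relabel (K : Kin (m + 2)) :
    D.boxDenominator (K.relabel (Equiv.swap (legA m) (legB m))) =
      K.angle D.p D.q * K.angle D.q (legB m) * K.angle (legB m) (legA m) *
        K.angle (legA m) D.p := by
  simp only [boxDenominator, Kin.angle, Kin.relabel, swap_p, swap_q, Equiv.swap_apply_left,
    Equiv.swap_apply_right]

/-! ### Kinematics of the box -/

/-- Each spectator has one of the two factors of `λ λ̃` set to zero. -/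
theorem mom_eq_zero_of_mem_support {K : Kin (m + 2)} {α : Fin D.bridges.length → ℂ}
    (hα : α ∈ D.support K) (i : D.Spectator) : (D.hat K α).mom i = 0 := by
  ext x y
  have hx := hα.2 i x
  have hy := hα.2 i y
  simp only [deltaArg] at hx hy
  rw [Kin.mom, vecMulVec_apply]
  split_ifs at hx hy
  · simp [hy]
  · simp [hx]

theorem sum_box {M : Type*} [AddCommMonoid M] (f : Fin (m + 2) → M)
    (hf : ∀ i : D.Spectator, f i = 0) :
    ∑ i, f i = f D.p + f D.q + f (legA m) + f (legB m) := by
  have h1 := D.p_lt_q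
  have h2 := D.q_lt
  have h3 := legA_lt_legB (m := m)
  have h4 := h1.trans h2
  rw [← Finset.sum_subset (Finset.subset_univ {D.p, D.q, legA m, legB m}),
    Finset.sum_insert, Finset.sum_insert, Finset.sum_pair h3.ne, add_assoc, add_assoc]
  · simp [h2.ne, (h2.trans h3).ne]
  · simp [h1.ne, h4.ne, (h4.trans h3).ne]
  · intro i _ hi
    simp only [Finset.mem_insert, Finset.mem_singleton, not_or] at hi
    exact hf ⟨i, hi⟩

theorem Proper.sum_mom_box (h : D.Proper) {K : Kin (m + 2)} {α : Fin D.bridges.length → ℂ}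
    (hK : K.MomentumConserving) (hα : α ∈ D.support K) :
    (D.hat K α).mom D.p + (D.hat K α).mom D.q + (D.hat K α).mom (legA m)
      + (D.hat K α).mom (legB m) = 0 := by
  rw [← sum_box _ (mom_eq_zero_of_mem_support hα)]
  exact (sum_mom_shifts K _ h.ne).trans hK

end BoxDiagram

/-- Four-point kinematics: the opposite Mandelstam variables agree. -/
theorem Kin.s_eq_of_add_eq_zero {n : ℕ} {K : Kin n} {p q a b : Fin n}
    (h : K.mom p + K.mom q + K.mom a + K.mom b = 0) : K.s q a = K.s p b := by
  have : K.mom q + K.mom a = -(K.mom p + K.mom b) :=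
    eq_neg_of_add_eq_zero_left (by rw [← h]; abel)
  rw [Kin.s, this, det_neg, Kin.s]
  simp

/-- The equality of opposite Mandelstam variables supplies the nonvanishing of the brackets with
`p`. -/
theorem Kin.s_div_s {n : ℕ} {K : Kin n} {p q a b : Fin n}
    (h : K.mom p + K.mom q + K.mom a + K.mom b = 0) (ha : K.s q a ≠ 0) (hb : K.s q b ≠ 0) :
    K.angle q a ≠ 0 ∧ K.angle q b ≠ 0 ∧ K.angle p a ≠ 0 ∧ K.angle p b ≠ 0 ∧
    K.s q a / K.s q b = -(K.angle q a * K.angle p b) / (K.angle q b * K.angle p a) := by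
  have ha' := ha
  have hb' := hb
  rw [Kin.s_eq_of_add_eq_zero h] at ha'
  rw [Kin.s_eq_of_add_eq_zero (p := p) (a := b) (b := a) (by rw [← h]; abel)] at hb'
  rw [Kin.s_eq] at ha hb ha' hb'
  have h1 := left_ne_zero_of_mul ha
  have h2 := left_ne_zero_of_mul hb
  have h3 := left_ne_zero_of_mul hb'
  have h4 := left_ne_zero_of_mul ha'
  refine ⟨h1, h2, h3, h4, ?_⟩
  have h5 := right_ne_zero_of_mul hb
  rw [Kin.s_eq, Kin.s_eq, div_eq_div_iff (mul_ne_zero h2 h5) (mul_ne_zero h2 h3)]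
  have e : ∀ x y, K.lam p x * K.lamt p y + K.lam q x * K.lamt q y + K.lam a x * K.lamt a y
      + K.lam b x * K.lamt b y = 0 := fun x y => by
    simpa [Kin.mom, vecMulVec_apply] using congrFun (congrFun h x) y
  -- This is momentum conservation contracted with `λ_p` and `λ̃_q`, which removes the terms of `p`
  -- and `q`.
  have key : (K.lamt q 0 * K.lamt a 1 - K.lamt q 1 * K.lamt a 0) * K.angle p a =
      -(K.angle p b * (K.lamt q 0 * K.lamt b 1 - K.lamt q 1 * K.lamt b 0)) := by
    simp only [Kin.angle]
    linear_combination K.lam p 0 * K.lamt q 0 * e 1 1 - K.lam p 1 * K.lamt q 0 * e 0 1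
      - K.lam p 0 * K.lamt q 1 * e 1 0 + K.lam p 1 * K.lamt q 1 * e 0 0
  linear_combination K.angle q a * K.angle q b * key

/-! ### ### The permutation relation -/

namespace BoxDiagram

variable {D : BoxDiagram m}

/-- Everything but the box denominator is invariant, and exchanging neighbours in `⟨p q⟩⟨q n-1⟩⟨n-1
n⟩⟨n p⟩` produces exactly the bracket ratio of `Kin.s_div_s`. -/
theorem Proper.yangian_relabel (h : D.Proper) (e : Fin D.bridges.length ≃ D.Spectator × Fin 2)
    {K : Kin (m + 2)} {α : Fin D.bridges.length → ℂ} (hK : K.MomentumConserving)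
    (hα : D.support K = {α}) (hA : (D.hat K α).s D.q (legA m) ≠ 0)
    (hB : (D.hat K α).s D.q (legB m) ≠ 0) :
    D.yangian e (K.relabel (Equiv.swap (legA m) (legB m))) =
      ((D.hat K α).s D.q (legA m) / (D.hat K α).s D.q (legB m)) • D.yangian e K := by
  obtain ⟨h1, h2, h3, h4, h5⟩ := Kin.s_div_s (h.sum_mom_box hK (hα ▸ rfl)) hA hB
  rw [yangian_of_support e hα, yangian_of_support e ((h.support_relabel K).trans hα),
    h.jacobian_relabel, h.fermionicDelta_relabel, h.hat_relabel, boxDenominator_relabel,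
    smul_smul, h5, boxDenominator, (D.hat K α).angle_swap (legB m) (legA m),
    (D.hat K α).angle_swap (legB m) D.p, (D.hat K α).angle_swap (legA m) D.p]
  congr 1
  -- The Jacobian, `⟨p q⟩` and `⟨n-1 n⟩` are not known to be nonzero; their inverses are common
  -- factors of both sides, so the identity also holds with `0⁻¹ = 0`.
  simp only [mul_inv, inv_neg]
  field_simp

/-! ### On-shell conditions for the bridge parameters -/

/-- If the columns of `C` fall into two sets whose spans meet in a line, then the partial sums of
`Λ Λ̃` with `Λ` in the row span of `C` and `C Λ̃ = 0` are singular. -/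
theorem FactorsAlong.det_sum_eq_zero {k n : ℕ} {C : Matrix (Fin k) (Fin n) ℂ}
    {L : Finset (Fin n)} (h : FactorsAlong C L) (hC : C.rank = k) (M : Matrix (Fin 2) (Fin k) ℂ)
    {X : Matrix (Fin n) (Fin 2) ℂ} (hX : C * X = 0) :
    (∑ i ∈ L, vecMulVec (fun x => (M * C) x i) (X i)).det = 0 := by
  let V : Finset (Fin n) → Submodule ℂ (Fin k → ℂ) := fun S =>
    LinearMap.range (C.submatrix id (fun i : S => (i : Fin n))).mulVecLin
  have hmem : ∀ (S : Finset (Fin n)) (v : Fin n → ℂ),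
      (fun r => ∑ i ∈ S, C r i * v i) ∈ V S := fun S v => by
    refine ⟨fun i => v i, ?_⟩
    funext r
    simp only [mulVecLin_apply, mulVec, dotProduct, submatrix_apply, id]
    exact Finset.sum_coe_sort S fun i => C r i * v i
  have htop : V L ⊔ V Lᶜ = ⊤ := by
    have hr : LinearMap.range C.mulVecLin = ⊤ :=
      Submodule.eq_top_of_finrank_eq (by rw [Module.finrank_fin_fun]; exact hC)
    rw [eq_top_iff, ← hr]
    rintro _ ⟨v, rfl⟩
    have : C.mulVecLin v =
        (fun r => ∑ i ∈ L, C r i * v i) + fun r => ∑ i ∈ Lᶜ, C r i * v i := by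
      funext r
      simp only [mulVecLin_apply, mulVec, dotProduct, Pi.add_apply]
      exact (Finset.sum_add_sum_compl L _).symm
    rw [this]
    exact Submodule.add_mem_sup (hmem _ v) (hmem _ v)
  have hinf : Module.finrank ℂ (V L ⊓ V Lᶜ : Submodule ℂ (Fin k → ℂ)) = 1 := by
    have h1 := Submodule.finrank_sup_add_finrank_inf_eq (V L) (V Lᶜ)
    rw [htop, finrank_top, Module.finrank_fin_fun] at h1
    have h2 : Module.finrank ℂ (V L) + Module.finrank ℂ (V Lᶜ) = k + 1 := h
    omega
  let Y : Matrix (Fin k) (Fin 2) ℂ := Matrix.of fun r y => ∑ i ∈ L, C r i * X i y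
  -- The range of `Y` lies in `V L` by construction, and in `V Lᶜ` because `C * X = 0` makes the sum
  -- over `L` minus the sum over `Lᶜ`.
  have hY : Y.rank ≤ 1 := by
    rw [← hinf]
    refine Submodule.finrank_mono ?_
    rintro _ ⟨v, rfl⟩
    have e1 : Y.mulVecLin v = fun r => ∑ i ∈ L, C r i * (X *ᵥ v) i := by
      funext r
      simp only [mulVecLin_apply, mulVec, dotProduct, Y, of_apply, Finset.sum_mul,
        Finset.mul_sum, mul_assoc]
      exact Finset.sum_comm
    have e2 : Y.mulVecLin v = fun r => ∑ i ∈ Lᶜ, C r i * (-(X *ᵥ v)) i := by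
      rw [e1]
      funext r
      have h0 : (C *ᵥ (X *ᵥ v)) r = 0 := by rw [mulVec_mulVec, hX, zero_mulVec]; rfl
      rw [mulVec, dotProduct, ← Finset.sum_add_sum_compl L] at h0
      simp only [Pi.neg_apply, mul_neg, Finset.sum_neg_distrib]
      exact eq_neg_of_add_eq_zero_left h0
    exact ⟨e1 ▸ hmem _ _, e2 ▸ hmem _ _⟩
  have hsum : ∑ i ∈ L, vecMulVec (fun x => (M * C) x i) (X i) = M * Y := by
    ext x y
    simp only [Matrix.sum_apply, vecMulVec_apply, mul_apply, Y, of_apply, Finset.sum_mul,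
      Finset.mul_sum, mul_assoc]
    exact Finset.sum_comm
  rw [hsum]
  by_contra hdet
  have h2 := rank_of_isUnit (M * Y) ((isUnit_iff_isUnit_det _).2 (Ne.isUnit hdet))
  have h3 := (rank_mul_le_right M Y).trans hY
  rw [h2, Fintype.card_fin] at h3
  omega

/-- Each unit row has its pivot in a column outside the box, and the columns `q` and `n - 1` of the
box rows have determinant `⟨q n-1⟩`. -/
theorem rank_seedMatrix {K : Kin (m + 2)} (h : K.angle D.q (legA m) ≠ 0) :
    (D.seedMatrix K).rank = D.k := by
  have hli : LinearIndependent ℂ (D.seedMatrix K).row := by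
    rw [← vecMul_injective_iff, ← coe_vecMulLinear, injective_iff_map_eq_zero]
    intro v hv
    have hcol : ∀ i, ∑ x : Fin 2, v (finSumFinEquiv (Sum.inl x)) *
        (if i = D.p ∨ i = D.q ∨ i = legA m ∨ i = legB m then K.lam i x else 0) +
        ∑ u, v (finSumFinEquiv (Sum.inr u)) *
        (if i = D.unit.orderEmbOfFin rfl u then 1 else 0) = 0 := by
      intro i
      have := congrFun hv i
      simp only [vecMulLinear_apply, vecMul, dotProduct, seedMatrix, of_apply,
        Pi.zero_apply] at this
      erw [← finSumFinEquiv.sum_comp] at this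
      simpa [Fintype.sum_sum_type] using this
    have hunit : ∀ u, v (finSumFinEquiv (Sum.inr u)) = 0 := by
      intro u
      have hu := D.unit_spec _ (D.unit.orderEmbOfFin_mem rfl u)
      simpa [hu] using hcol (D.unit.orderEmbOfFin rfl u)
    simp only [hunit, zero_mul, Finset.sum_const_zero, add_zero, Fin.sum_univ_two] at hcol
    have hq := hcol D.q
    have hA := hcol (legA m)
    simp only [true_or, or_true, if_true] at hq hA
    rw [Kin.angle] at h
    have h0 : v (finSumFinEquiv (Sum.inl 0)) = 0 := by
      refine (mul_eq_zero.1 ?_).resolve_left h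
      linear_combination K.lam (legA m) 1 * hq - K.lam D.q 1 * hA
    have h1 : v (finSumFinEquiv (Sum.inl 1)) = 0 := by
      refine (mul_eq_zero.1 ?_).resolve_left h
      linear_combination K.lam D.q 0 * hA - K.lam (legA m) 0 * hq
    funext r
    obtain ⟨r, rfl⟩ := finSumFinEquiv.surjective r
    rcases r with x | u
    · fin_cases x
      exacts [h0, h1]
    · exact hunit u
  rw [hli.rank_matrix, Fintype.card_fin]

/-- On the support of the delta functions the `λ`-plane lies in the row span of `C₀`. -/
theorem exists_mul_seedMatrix {K : Kin (m + 2)} {α : Fin D.bridges.length → ℂ}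
    (hα : α ∈ D.support K) :
    ∃ M : Matrix (Fin 2) (Fin D.k) ℂ,
      M * D.seedMatrix (D.hat K α) = (D.hat K α).lamMatrix := by
  -- The box rows already contain the `λ` of the box; the unit row of `u` is weighted by `λ_u`. The
  -- remaining columns vanish on both sides, by the delta functions.
  refine ⟨Matrix.of fun x r => Sum.elim (fun y => if x = y then 1 else 0)
    (fun u => (D.hat K α).lam (D.unit.orderEmbOfFin rfl u) x) (finSumFinEquiv.symm r), ?_⟩
  ext x i
  simp only [mul_apply, seedMatrix, of_apply, Kin.lamMatrix]
  erw [← finSumFinEquiv.sum_comp]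
  simp only [Equiv.symm_apply_apply, Fintype.sum_sum_type, Sum.elim_inl, Sum.elim_inr, ite_mul,
    one_mul, zero_mul]
  rw [Finset.sum_ite_eq, if_pos (Finset.mem_univ _)]
  simp only [mul_ite, mul_one, mul_zero]
  by_cases hbox : i = D.p ∨ i = D.q ∨ i = legA m ∨ i = legB m
  · rw [if_pos hbox, Finset.sum_eq_zero, add_zero]
    intro u _
    have hu := D.unit_spec _ (D.unit.orderEmbOfFin_mem rfl u)
    rw [if_neg]
    rintro rfl
    tauto
  · rw [if_neg hbox, zero_add]
    by_cases hi : i ∈ D.unit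
    · obtain ⟨u, hu⟩ : ∃ u, D.unit.orderEmbOfFin rfl u = i := by
        have : i ∈ Set.range (D.unit.orderEmbOfFin rfl) := by
          rw [Finset.range_orderEmbOfFin]; exact hi
        exact this
      subst hu
      simp
    · rw [Finset.sum_eq_zero]
      · simp only [not_or] at hbox
        have := hα.2 ⟨i, hbox⟩ x
        rw [deltaArg, if_neg hi] at this
        exact this.symm
      · intro u _
        rw [if_neg]
        rintro rfl
        exact hi (D.unit.orderEmbOfFin_mem rfl u)

/-- On the support of the delta functions the `λ̃`-plane is orthogonal to `C₀`. -/
theorem Proper.seedMatrix_mul_lamt (h : D.Proper) {K : Kin (m + 2)}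
    {α : Fin D.bridges.length → ℂ} (hK : K.MomentumConserving) (hα : α ∈ D.support K) :
    D.seedMatrix (D.hat K α) * (D.hat K α).lamtMatrix = 0 := by
  ext r y
  simp only [mul_apply, seedMatrix, of_apply, Kin.lamtMatrix, Matrix.zero_apply]
  rcases finSumFinEquiv.symm r with x | u
  · simp only [Sum.elim_inl]
    rw [sum_box (D := D)]
    · simpa [Kin.mom, vecMulVec_apply] using
        congrFun (congrFun (h.sum_mom_box hK hα) x) y
    · intro i
      have := i.2
      simp [this]
  · simp only [Sum.elim_inr, ite_mul, one_mul, zero_mul, Finset.sum_ite_eq', Finset.mem_univ,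
      if_true]
    have hu := D.unit.orderEmbOfFin_mem rfl u
    have := hα.2 ⟨_, D.unit_spec _ hu⟩ y
    rwa [deltaArg, if_pos hu] at this

/-- The on-shell expression is the momentum of `L` after bridge `I` has been removed too, which
explains the index `I + 1` of the matrix. The nonzero bracket guarantees full rank. -/
theorem Proper.det_onShell (h : D.Proper) {K : Kin (m + 2)} {α : Fin D.bridges.length → ℂ}
    (hK : K.MomentumConserving) (hα : α ∈ D.support K)
    (hA : (D.hat K α).angle D.q (legA m) ≠ 0) (I : Fin D.bridges.length)
    {L : Finset (Fin (m + 2))} (ha : (D.bridges.get I).1 ∈ L) (hb : (D.bridges.get I).2 ∉ L)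
    (hL : FactorsAlong (D.partialMatrix K α (I + 1)) L) :
    ((∑ i ∈ L, (K.shifts ((D.dressed α).take I)).mom i) +
      α I • vecMulVec ((K.shifts ((D.dressed α).take I)).lam (D.bridges.get I).1)
        ((K.shifts ((D.dressed α).take I)).lamt (D.bridges.get I).2)).det = 0 := by
  have hI : (I : ℕ) < (D.dressed α).length := by simp [dressed]
  have htake : (K.shifts ((D.dressed α).take I)).shift (D.bridges.get I).1 (D.bridges.get I).2
      (α I) = K.shifts ((D.dressed α).take (I + 1)) := by
    rw [← List.take_append_getElem hI, Kin.shifts_append]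
    simp [dressed, Kin.shifts]
  rw [← Kin.sum_mom_shift _ _ ha hb, htake]
  have hhat : D.hat K α =
      (K.shifts ((D.dressed α).take (I + 1))).shifts ((D.dressed α).drop (I + 1)) := by
    rw [← Kin.shifts_append, List.take_append_drop, hat]
  generalize K.shifts ((D.dressed α).take (I + 1)) = K' at hhat ⊢
  have hne : ∀ b ∈ (D.dressed α).drop (I + 1), b.1.1 ≠ b.1.2 :=
    fun b hb => h.ne b (List.mem_of_mem_drop hb)
  obtain ⟨M, hM⟩ := exists_mul_seedMatrix hα
  have hlam : M * D.partialMatrix K α (I + 1) = K'.lamMatrix := by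
    rw [partialMatrix, ← Matrix.mul_assoc, hM, hhat, lamMatrix_shifts _ _ hne]
  have hrank : (D.partialMatrix K α (I + 1)).rank = D.k := by
    rw [partialMatrix, rank_mul_eq_left_of_isUnit_det, rank_seedMatrix hA]
    rw [det_bridgeMatrix _ hne]
    exact isUnit_one
  have hX : D.partialMatrix K α (I + 1) * K'.lamtMatrix = 0 := by
    rw [partialMatrix, Matrix.mul_assoc, ← lamtMatrix_shifts, ← hhat,
      h.seedMatrix_mul_lamt hK hα]
  have := hL.det_sum_eq_zero hrank M hX
  rw [hlam] at this
  exact this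

end BoxDiagram

end OnShell

theorem mainTheorem4 (m : ℕ) (σ : OnShell.DecoratedPerm (m + 2)) (hσ : σ.BoxCondition) :
    -- `σ` has an on-shell diagram with a box attached directly to the legs `n - 1` and `n`
    (∃ D : OnShell.BoxDiagram m, D.Represents σ) ∧
    ∀ D : OnShell.BoxDiagram m, D.Represents σ →
      D.k = σ.k ∧
      -- tree level: the delta functions fix all bridge parameters, uniquely
      ∀ (e : Fin D.bridges.length ≃ D.Spectator × Fin 2) (K : OnShell.Kin (m + 2))
        (α : Fin D.bridges.length → ℂ),
        K.MomentumConserving → D.support K = {α} →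
        (D.hat K α).s D.q (OnShell.legA m) ≠ 0 → (D.hat K α).s D.q (OnShell.legB m) ≠ 0 →
        -- the permutation relation
        D.yangian e (K.relabel (Equiv.swap (OnShell.legA m) (OnShell.legB m))) =
          ((D.hat K α).s D.q (OnShell.legA m) / (D.hat K α).s D.q (OnShell.legB m)) •
            D.yangian e K ∧
        -- the kinematic factor in terms of the lines attached to the box
        (D.hat K α).mom D.p + (D.hat K α).mom D.q + K.mom (OnShell.legA m)
          + K.mom (OnShell.legB m) = 0 ∧
        (D.hat K α).s D.q (OnShell.legA m) / (D.hat K α).s D.q (OnShell.legB m) =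
          - ((D.hat K α).angle D.q (OnShell.legA m) * (D.hat K α).angle D.p (OnShell.legB m)) /
            ((D.hat K α).angle D.q (OnShell.legB m) * (D.hat K α).angle D.p (OnShell.legA m)) ∧
        -- the recursion: the parameter of each bridge solves the on-shell condition of the
        -- internal line that separates its two ends once the bridge is removed
        ∀ (I : Fin D.bridges.length) (L : Finset (Fin (m + 2))),
          (D.bridges.get I).1 ∈ L → (D.bridges.get I).2 ∉ L →
          OnShell.BoxDiagram.FactorsAlong (D.partialMatrix K α (I + 1)) L →
          ((∑ i ∈ L, (K.shifts ((D.dressed α).take I)).mom i) +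
            α I • Matrix.vecMulVec ((K.shifts ((D.dressed α).take I)).lam (D.bridges.get I).1)
              ((K.shifts ((D.dressed α).take I)).lamt (D.bridges.get I).2)).det = 0 := by
  refine ⟨hσ.exists_represents, fun D hD => ⟨hD.k_eq, fun e K α hK hα hA hB => ?_⟩⟩
  have hP := hD.proper
  have hmem : α ∈ D.support K := hα ▸ rfl
  have hbox := hP.sum_mom_box hK hmem
  -- Of the nonvanishing brackets only `⟨q n-1⟩` is needed below, for the full rank of the partial
  -- matrices.
  obtain ⟨h1, -, -, -, h5⟩ := OnShell.Kin.s_div_s hbox hA hB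
  refine ⟨hP.yangian_relabel e hK hα hA hB, ?_, h5, fun I L ha hb hL =>
    hP.det_onShell hK hmem h1 I ha hb hL⟩
  -- The last two legs are never shifted, so their hatted momenta are the external ones.
  rw [← K.mom_shifts_of_ne (OnShell.legA m) _ hP.ne_legA,
    ← K.mom_shifts_of_ne (OnShell.legB m) _ hP.ne_legB]
  exact hbox
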